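/- Let $m\ge 0$ be an integer, $\beta>0$ and $0<c<1$ real numbers. Write $(a)_k=a(a+1)\cdots(a+k-1)$, and let $M_k(x;\beta,c)=(\beta)_k\,{}_2F_1(-k,-x;\beta;1-1/c)$ be the Meixner polynomials. For nonnegative integers $n_0$ and $\boldsymbol n=(n_1,\dots,n_m)$ put $$B^{(\beta)}(n_0,\boldsymbol n)=(-1)^{n_1+\cdots+n_m}c^{-n_0}(1-c)^{\beta+n_0}\sum_{x=0}^\infty x(x-1)\cdots(x-n_0+1)\,\frac{c^x(\beta)_x}{x!}\prod_{j=1}^m M_{n_j}(x;\beta,c).$$ All these series converge absolutely. The numbers $B^{(\beta)}(n_0,\boldsymbol n)$ have the generating function $$\sum_{n_0,\dots,n_m\ge 0}B^{(\beta)}(n_0,\boldsymbol n)\prod_{j=0}^m\frac{x_j^{n_j}}{n_j!} =\Bigl[1-\sum_{k=2}^m\frac{1-c^{1-k}}{c(1-c^{-1})}\,e_k(x_1,\dots,x_m)-x_0\prod_{j=1}^m(1+x_j/c)\Bigr]^{-\beta},$$ an identity of formal power series in $x_0,\dots,x_m$, where $e_k$ is the $k$-th elementary symmetric polynomial and, for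 a series $F$ with constant term $1$, $F^{-\beta}=\sum_{k\ge0}\binom{-\beta}{k}(F-1)^k$. Moreover, let $S_0,S_1,\dots,S_m$ be disjoint sets ("boxes") with $|S_j|=n_j$, and let $\mathfrak S^*(\boldsymbol n)$ be the set of permutations $\pi$ of $S_0\cup S_1\cup\cdots\cup S_m$ with $\pi(S_j)\cap S_j=\emptyset$ for $1\le j\le m$ (elements of $S_0$ are not restricted). Then $$B^{(\beta)}(n_0,\boldsymbol n)=\sum_{\pi\in\mathfrak S^*(\boldsymbol n)}\beta^{\operatorname{cyc}(\pi)}c^{-\operatorname{exc}(\pi)},$$ where $\operatorname{cyc}(\pi)$ is the number of cycles of $\pi$ (fixed points included) and $\operatorname{exc}(\pi)$ is the number of box-excedances of $\pi$, that is, of elements $a\in S_i$ with $\pi(a)\in S_j$ and $j>i$. -/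

import Mathlib

open scoped BigOperators

namespace Meixner

noncomputable section

/-- The Meixner polynomial `M_k(x; β, c) = (β)_k ₂F₁(-k, -x; β; 1 - 1/c)`, where `(β)_k` is the
rising factorial. -/
def meixnerPoly (k : ℕ) (x β c : ℝ) : ℝ :=
  (ascPochhammer ℝ k).eval β * ordinaryHypergeometric (-(k : ℝ)) (-x) β (1 - 1 / c)

/-- The summand `x(x-1)⋯(x-n₀+1) · c^x (β)_x / x! · ∏_j M_{n_j}(x; β, c)` at the integer `x`. -/
def summand {m : ℕ} (β c : ℝ) (n₀ : ℕ) (n : Fin m → ℕ) (x : ℕ) : ℝ :=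
  (descPochhammer ℝ n₀).eval (x : ℝ) * (c ^ x * (ascPochhammer ℝ x).eval β / (x.factorial : ℝ)) *
    ∏ j, meixnerPoly (n j) (x : ℝ) β c

/-- The generalized linearization coefficient `B^{(β)}(n₀, n)`. -/
def B {m : ℕ} (β c : ℝ) (n₀ : ℕ) (n : Fin m → ℕ) : ℝ :=
  (-1) ^ (∑ j, n j) * (c ^ n₀)⁻¹ * (1 - c) ^ (β + (n₀ : ℝ)) * ∑' x : ℕ, summand β c n₀ n x

/-- The exponential generating function
`∑ B^{(β)}(n₀, n) ∏_{j=0}^m x_j^{n_j} / n_j!` as a formal power series in `x_0, …, x_m`. -/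
def genFun (m : ℕ) (β c : ℝ) : MvPowerSeries (Fin (m + 1)) ℝ :=
  fun d => B β c (d 0) (fun j : Fin m => d j.succ) / ∏ j : Fin (m + 1), ((d j).factorial : ℝ)

/-- The elementary symmetric polynomial `e_k(x_1, …, x_m)`, in the variables `x_0, …, x_m`. -/
def elemSymm (m k : ℕ) : MvPolynomial (Fin (m + 1)) ℝ :=
  MvPolynomial.rename Fin.succ (MvPolynomial.esymm (Fin m) ℝ k)

/-- `1 - ∑_{k=2}^m (1 - c^{1-k}) / (c (1 - c⁻¹)) e_k(x_1, …, x_m) - x_0 ∏_{j=1}^m (1 + x_j / c)`. -/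
def bracket (m : ℕ) (c : ℝ) : MvPolynomial (Fin (m + 1)) ℝ :=
  1 - ∑ k ∈ Finset.Icc 2 m,
        MvPolynomial.C ((1 - c ^ (1 - (k : ℤ))) / (c * (1 - c⁻¹))) * elemSymm m k
    - MvPolynomial.X 0 * ∏ j : Fin m, (1 + MvPolynomial.C (1 / c) * MvPolynomial.X j.succ)

/-- The power `F ^ r = ∑_k (r choose k) (F - 1)^k` of a formal power series `F` with constant
coefficient `1`: the binomial series `(1 + T)^r` with `T = F - 1` substituted. -/
def seriesPow {σ : Type*} (F : MvPowerSeries σ ℝ) (r : ℝ) : MvPowerSeries σ ℝ :=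
  (PowerSeries.binomialSeries ℝ r).subst (F - 1)

/-- The disjoint union `S_0 ∪ S_1 ∪ ⋯ ∪ S_m` of boxes, with `n₀` objects in box `0` and `n_j`
objects in box `j` for `1 ≤ j ≤ m`. The first component of an object is the index of its box. -/
abbrev Obj {m : ℕ} (n₀ : ℕ) (n : Fin m → ℕ) : Type :=
  Σ j : Fin (m + 1), Fin ((Fin.cons n₀ n : Fin (m + 1) → ℕ) j)

/-- The permutations of `S_0 ∪ ⋯ ∪ S_m` that leave no object of a box `j ≥ 1` in its box; the
objects of box `0` are not restricted. -/
def starPerms {m : ℕ} (n₀ : ℕ) (n : Fin m → ℕ) : Finset (Equiv.Perm (Obj n₀ n)) :=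
  Finset.univ.filter fun π => ∀ a : Obj n₀ n, a.1 ≠ 0 → (π a).1 ≠ a.1

/-- The number of cycles of a permutation, fixed points included. -/
def cyc {α : Type*} [Fintype α] [DecidableEq α] (π : Equiv.Perm α) : ℕ :=
  π.cycleType.card + (Finset.univ.filter fun a => π a = a).card

/-- The number of box-excedances: objects that are sent to a box with a larger index. -/
def exc {m : ℕ} {n₀ : ℕ} {n : Fin m → ℕ} (π : Equiv.Perm (Obj n₀ n)) : ℕ :=
  (Finset.univ.filter fun a : Obj n₀ n => a.1 < (π a).1).card

end

end Meixner

/-!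
Up to elementary factors, the numbers `x (x - 1) ⋯ (x - n₀ + 1) * ∏ M_{n_j}(x)` at an integer `x`
are the coefficients of a power series `A * U ^ x` with `U` of constant term `1`. Summing over `x`
with the weights `c ^ x (β)_x / x!` amounts, coefficient by coefficient, to the negative binomial
series `∑ (β)_x c ^ x / x! * U ^ x = (1 - c * U) ^ (-β)`, and `A * (1 - c * U) ^ (-β)` is, up to a
constant, the bracket raised to the power `-β`.

For the permutations, the bracket is the MacMahon determinant `det (1 - diag(x_i) * W)`, where
`W i j` is the weight of a step from box `i` to box `j`. Its power with exponent a natural number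
`N` expands over the colorings of the objects with `N` colors, and a permutation `π` leaves
`N ^ cyc π` of them invariant, so that the coefficients are sums over permutations weighted by
`(-N) ^ cyc π`. Both sides are polynomials in the exponent, hence they also agree at `-β`.
-/

namespace Meixner

open MvPowerSeries (coeff constantCoeff)

section SeriesPow

variable {σ : Type*}

theorem coeff_mul_subst {R : Type*} [CommRing R] {a : MvPowerSeries σ R}
    (ha : constantCoeff a = 0) (f : PowerSeries R) (g : MvPowerSeries σ R) (d : σ →₀ ℕ) :
    coeff d (g * f.subst a) =
      ∑ k ∈ Finset.range (d.degree + 1), PowerSeries.coeff k f * coeff d (g * a ^ k) := by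
  have hs : PowerSeries.HasSubst a := .of_constantCoeff_zero ha
  obtain ⟨h, hf⟩ : ∃ h, f.subst a = a ^ (d.degree + 1) * h +
      Polynomial.aeval a (PowerSeries.trunc (d.degree + 1) f) := by
    have h := congrArg (PowerSeries.subst a)
      (PowerSeries.eq_X_pow_mul_shift_add_trunc (d.degree + 1) f)
    rw [PowerSeries.subst_add hs, PowerSeries.subst_mul hs, PowerSeries.subst_pow hs,
      PowerSeries.subst_X hs, PowerSeries.subst_coe hs] at h
    exact ⟨_, h⟩
  have htail : coeff d (a ^ (d.degree + 1) * (g * h)) = 0 := by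
    refine MvPowerSeries.coeff_of_lt_order ?_
    calc (d.degree : ℕ∞) < (d.degree + 1 : ℕ) := by exact_mod_cast Nat.lt_succ_self _
      _ ≤ (a ^ (d.degree + 1)).order := MvPowerSeries.le_order_pow_of_constantCoeff_eq_zero _ ha
      _ ≤ (a ^ (d.degree + 1)).order + (g * h).order := le_self_add
      _ ≤ _ := MvPowerSeries.le_order_mul
  rw [hf, mul_add, mul_left_comm, map_add, htail, zero_add,
    Polynomial.aeval_eq_sum_range' (PowerSeries.natDegree_trunc_lt f _), Finset.mul_sum, map_sum]
  refine Finset.sum_congr rfl fun k hk => ?_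
  rw [mul_smul_comm, map_smul, PowerSeries.coeff_trunc, if_pos (Finset.mem_range.mp hk),
    smul_eq_mul]

theorem coeff_mul_seriesPow {F : MvPowerSeries σ ℝ} (hF : constantCoeff F = 1) (r : ℝ)
    (g : MvPowerSeries σ ℝ) (d : σ →₀ ℕ) :
    coeff d (g * seriesPow F r) =
      ∑ k ∈ Finset.range (d.degree + 1), Ring.choose r k * coeff d (g * (F - 1) ^ k) := by
  rw [seriesPow, coeff_mul_subst (by simp [hF])]
  simp only [PowerSeries.binomialSeries_coeff, smul_eq_mul, mul_one]

theorem seriesPow_natCast {F : MvPowerSeries σ ℝ} (hF : constantCoeff F = 1) (N : ℕ) :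
    seriesPow F (N : ℝ) = F ^ N := by
  have hs : PowerSeries.HasSubst (F - 1) := .of_constantCoeff_zero (by simp [hF])
  rw [seriesPow, PowerSeries.binomialSeries_nat, PowerSeries.subst_pow hs,
    PowerSeries.subst_add hs, PowerSeries.subst_X hs, ← PowerSeries.coe_substAlgHom hs, map_one,
    add_sub_cancel]

theorem coeff_mul_pow_eq_sum_choose {F : MvPowerSeries σ ℝ} (hF : constantCoeff F = 1) (N : ℕ)
    (g : MvPowerSeries σ ℝ) (d : σ →₀ ℕ) :
    coeff d (g * F ^ N) =
      ∑ k ∈ Finset.range (d.degree + 1), (N.choose k : ℝ) * coeff d (g * (F - 1) ^ k) := by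
  simp only [← seriesPow_natCast hF, coeff_mul_seriesPow hF, Ring.choose_natCast]

theorem exists_eval_eq_choose (k : ℕ) :
    ∃ p : Polynomial ℝ, ∀ r, p.eval r = Ring.choose r k := by
  refine ⟨.C (k.factorial : ℝ)⁻¹ * (descPochhammer ℤ k).map (Int.castRingHom ℝ), fun r => ?_⟩
  rw [Ring.choose_eq_smul, Polynomial.eval_mul, Polynomial.eval_C, Polynomial.eval_map,
    ← Polynomial.eval₂_smulOneHom_eq_smeval, smul_eq_mul,
    Subsingleton.elim (Int.castRingHom ℝ) RingHom.smulOneHom]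

theorem polynomial_eq_of_eval_natCast {R : Type*} [CommRing R] [IsDomain R] [CharZero R]
    {p q : Polynomial R} (h : ∀ N : ℕ, p.eval (N : R) = q.eval (N : R)) : p = q :=
  Polynomial.eq_of_infinite_eval_eq p q <|
    (Set.infinite_range_of_injective Nat.cast_injective).mono (Set.range_subset_iff.mpr h)

/-- A one-parameter family of power series each of whose coefficients is a polynomial function of
the parameter. Such a family is determined by its members at the natural numbers, which reduces
identities between real powers to identities between natural powers. -/
def IsPolyFamily (Φ : ℝ → MvPowerSeries σ ℝ) : Prop :=
  ∀ d, ∃ p : Polynomial ℝ, ∀ r, p.eval r = coeff d (Φ r)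

theorem IsPolyFamily.eq_of_natCast {Φ Ψ : ℝ → MvPowerSeries σ ℝ} (hΦ : IsPolyFamily Φ)
    (hΨ : IsPolyFamily Ψ) (h : ∀ N : ℕ, Φ N = Ψ N) (r : ℝ) : Φ r = Ψ r := by
  ext d
  obtain ⟨p, hp⟩ := hΦ d
  obtain ⟨q, hq⟩ := hΨ d
  rw [← hp, ← hq, polynomial_eq_of_eval_natCast (p := p) (q := q) fun N => by rw [hp, hq, h N]]

theorem isPolyFamily_const (F : MvPowerSeries σ ℝ) : IsPolyFamily fun _ => F :=
  fun d => ⟨.C (coeff d F), fun _ => Polynomial.eval_C⟩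

theorem IsPolyFamily.mul {Φ Ψ : ℝ → MvPowerSeries σ ℝ} (hΦ : IsPolyFamily Φ)
    (hΨ : IsPolyFamily Ψ) : IsPolyFamily fun r => Φ r * Ψ r := by
  classical
  intro d
  choose p hp using hΦ
  choose q hq using hΨ
  refine ⟨∑ e ∈ Finset.HasAntidiagonal.antidiagonal d, p e.1 * q e.2, fun r => ?_⟩
  simp only [Polynomial.eval_finsetSum, Polynomial.eval_mul, hp, hq, MvPowerSeries.coeff_mul]

theorem isPolyFamily_seriesPow {F : MvPowerSeries σ ℝ} (hF : constantCoeff F = 1) :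
    IsPolyFamily (seriesPow F) := by
  intro d
  choose p hp using exists_eval_eq_choose
  refine ⟨∑ k ∈ Finset.range (d.degree + 1), p k * .C (coeff d ((F - 1) ^ k)), fun r => ?_⟩
  have h := coeff_mul_seriesPow hF r 1 d
  simp only [one_mul] at h
  simp only [h, Polynomial.eval_finsetSum, Polynomial.eval_mul, Polynomial.eval_C, hp]

theorem seriesPow_one (r : ℝ) : seriesPow (1 : MvPowerSeries σ ℝ) r = 1 :=
  (isPolyFamily_seriesPow (map_one _)).eq_of_natCast (isPolyFamily_const 1)
    (fun N => by rw [seriesPow_natCast (map_one _), one_pow]) r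

theorem seriesPow_mul {F G : MvPowerSeries σ ℝ} (hF : constantCoeff F = 1)
    (hG : constantCoeff G = 1) (r : ℝ) :
    seriesPow (F * G) r = seriesPow F r * seriesPow G r := by
  have hFG : constantCoeff (F * G) = 1 := by rw [map_mul, hF, hG, one_mul]
  refine (isPolyFamily_seriesPow hFG).eq_of_natCast
    ((isPolyFamily_seriesPow hF).mul (isPolyFamily_seriesPow hG)) (fun N => ?_) r
  rw [seriesPow_natCast hF, seriesPow_natCast hG, seriesPow_natCast hFG, mul_pow]

theorem seriesPow_prod {ι : Type*} (s : Finset ι) {F : ι → MvPowerSeries σ ℝ}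
    (hF : ∀ i ∈ s, constantCoeff (F i) = 1) (r : ℝ) :
    seriesPow (∏ i ∈ s, F i) r = ∏ i ∈ s, seriesPow (F i) r := by
  classical
  induction s using Finset.induction_on with
  | empty => simp only [Finset.prod_empty, seriesPow_one]
  | insert i s hi ih =>
    rw [Finset.forall_mem_insert] at hF
    rw [Finset.prod_insert hi, Finset.prod_insert hi,
      seriesPow_mul hF.1 (by rw [map_prod, Finset.prod_eq_one hF.2]), ih hF.2]

end SeriesPow

section SubstX

variable {σ R : Type*} [CommRing R]

theorem coeff_prod_subst_X [Fintype σ] (f : σ → PowerSeries R) (d : σ →₀ ℕ) :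
    coeff d (∏ i, (f i).subst (MvPowerSeries.X i : MvPowerSeries σ R)) =
      ∏ i, PowerSeries.coeff (d i) (f i) := by
  classical
  rw [MvPowerSeries.coeff_prod,
    Finset.sum_eq_single (Finsupp.equivFunOnFinite.symm fun i => Finsupp.single i (d i))]
  · simp [PowerSeries.coeff_subst_single]
  · intro l hl hne
    rw [Finset.mem_finsuppAntidiag] at hl
    by_contra h
    have hsingle : ∀ i, l i = Finsupp.single i (l i i) := fun i => by
      by_contra hi
      exact h (Finset.prod_eq_zero (Finset.mem_univ i)
        (by rw [PowerSeries.coeff_subst_single, if_neg hi]))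
    have hdiag : ∀ i, d i = l i i := fun i => by
      rw [← hl.1, Finsupp.finsetSum_apply, Finset.sum_eq_single i]
      · intro k _ hk
        rw [hsingle k, Finsupp.single_apply, if_neg hk]
      · simp
    refine hne (Finsupp.ext fun i => ?_)
    rw [hsingle i, Finsupp.equivFunOnFinite_symm_apply_apply, hdiag]
  · refine fun h => absurd (Finset.mem_finsuppAntidiag.mpr ⟨?_, Finset.subset_univ _⟩) h
    ext j
    simp

theorem constantCoeff_subst_X (f : PowerSeries R) (i : σ) :
    constantCoeff (f.subst (MvPowerSeries.X i : MvPowerSeries σ R)) =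
      PowerSeries.constantCoeff f := by
  classical
  rw [← MvPowerSeries.coeff_zero_eq_constantCoeff_apply, PowerSeries.coeff_subst_single]
  simp

theorem subst_X_one_add_C_mul_X (a : R) (i : σ) :
    (1 + PowerSeries.C a * PowerSeries.X : PowerSeries R).subst
        (MvPowerSeries.X i : MvPowerSeries σ R) =
      1 + MvPowerSeries.C a * MvPowerSeries.X i := by
  have hs : PowerSeries.HasSubst (MvPowerSeries.X i : MvPowerSeries σ R) := .X i
  rw [PowerSeries.subst_add hs, PowerSeries.subst_mul hs, PowerSeries.subst_X hs,
    PowerSeries.subst_C, ← PowerSeries.coe_substAlgHom hs, map_one]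

end SubstX

section Weight

theorem ascPochhammer_eval_add {R : Type*} [CommSemiring R] (b : R) (j i : ℕ) :
    (ascPochhammer R (j + i)).eval b =
      (ascPochhammer R j).eval b * (ascPochhammer R i).eval (b + j) := by
  simp [← ascPochhammer_mul, Polynomial.eval_comp]

theorem multichoose_eq_div {R : Type*} [Field R] [CharZero R] [BinomialRing R] (b : R) (n : ℕ) :
    Ring.multichoose b n = (ascPochhammer R n).eval b / n.factorial := by
  rw [eq_div_iff (Nat.cast_ne_zero.mpr n.factorial_ne_zero), mul_comm, ← nsmul_eq_mul,
    Ring.factorial_nsmul_multichoose_eq_ascPochhammer, Polynomial.ascPochhammer_smeval_eq_eval]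

theorem choose_neg_eq_div (b : ℝ) (n : ℕ) :
    Ring.choose (-b) n = (-1) ^ n * ((ascPochhammer ℝ n).eval b / n.factorial) := by
  rw [Ring.choose_neg', multichoose_eq_div, Int.negOnePow_def, zpow_natCast, Units.smul_def]
  simp

theorem descPochhammer_eval_natCast {R : Type*} [CommRing R] (x k : ℕ) :
    (descPochhammer R k).eval (x : R) = k.factorial * x.choose k := by
  rw [descPochhammer_eval_eq_descFactorial, Nat.descFactorial_eq_factorial_mul_choose,
    Nat.cast_mul]

/-- The weight `c ^ x (β)_x / x!` of the Meixner polynomials. -/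
noncomputable def weight (β c : ℝ) (x : ℕ) : ℝ :=
  c ^ x * (ascPochhammer ℝ x).eval β / x.factorial

theorem hasSum_weight (β : ℝ) {c : ℝ} (hc : |c| < 1) :
    HasSum (weight β c) ((1 - c) ^ (-β)) := by
  have h := (Real.one_div_one_sub_rpow_hasFPowerSeriesOnBall_zero β).hasSum (y := c) (by
    simpa [enorm_eq_nnnorm, ← NNReal.coe_lt_coe] using hc)
  rw [zero_add, one_div, ← Real.rpow_neg (by linarith [(abs_lt.mp hc).2])] at h
  refine (congrArg (HasSum · _) (funext fun x => ?_)).mpr h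
  rw [FormalMultilinearSeries.ofScalars_apply_eq, ← Ring.multichoose_eq, multichoose_eq_div,
    smul_eq_mul, weight]
  ring

theorem hasSum_weight_mul_choose (β : ℝ) {c : ℝ} (hc : |c| < 1) (k : ℕ) :
    HasSum (fun x => weight β c x * x.choose k)
      ((ascPochhammer ℝ k).eval β / k.factorial * c ^ k * (1 - c) ^ (-β - k)) := by
  rw [← hasSum_nat_add_iff' k, Finset.sum_eq_zero fun i hi => by
    rw [Nat.choose_eq_zero_of_lt (Finset.mem_range.mp hi), Nat.cast_zero, mul_zero], sub_zero,
    ← neg_add']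
  refine (congrArg (HasSum · _) (funext fun y => ?_)).mpr
    ((hasSum_weight (β + k) hc).mul_left ((ascPochhammer ℝ k).eval β / k.factorial * c ^ k))
  rw [weight, weight, add_comm y k, Nat.cast_add_choose, ascPochhammer_eval_add, pow_add]
  field_simp

theorem hasSum_weight_mul_coeff_mul_pow {σ : Type*} (β : ℝ) {c : ℝ} (hc : |c| < 1)
    {U : MvPowerSeries σ ℝ} (hU : constantCoeff U = 1) (g : MvPowerSeries σ ℝ) (d : σ →₀ ℕ) :
    HasSum (fun x => weight β c x * coeff d (g * U ^ x))
      ((1 - c) ^ (-β) *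
        coeff d (g * seriesPow (1 - MvPowerSeries.C (c / (1 - c)) * (U - 1)) (-β))) := by
  have hc' : 0 < 1 - c := sub_pos.mpr (abs_lt.mp hc).2
  have hpow (k : ℕ) : (1 - MvPowerSeries.C (c / (1 - c)) * (U - 1) - 1) ^ k =
      MvPowerSeries.C ((-(c / (1 - c))) ^ k) * (U - 1) ^ k := by
    rw [sub_sub_cancel_left, ← neg_mul, ← map_neg, mul_pow, map_pow]
  have hcst : constantCoeff (1 - MvPowerSeries.C (c / (1 - c)) * (U - 1)) = 1 := by simp [hU]
  simp only [coeff_mul_seriesPow hcst, coeff_mul_pow_eq_sum_choose hU, Finset.mul_sum]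
  refine hasSum_sum fun k _ => ?_
  have hvalue : (1 - c) ^ (-β) * (Ring.choose (-β) k *
      coeff d (g * (1 - MvPowerSeries.C (c / (1 - c)) * (U - 1) - 1) ^ k)) =
      (ascPochhammer ℝ k).eval β / k.factorial * c ^ k * (1 - c) ^ (-β - k) *
        coeff d (g * (U - 1) ^ k) := by
    have hsign : ((-1 : ℝ) ^ k) * (-1) ^ k = 1 := by rw [← mul_pow]; simp
    rw [hpow, mul_left_comm g, MvPowerSeries.coeff_C_mul, choose_neg_eq_div, Real.rpow_sub hc',
      Real.rpow_natCast, neg_pow (c / (1 - c)), div_pow]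
    linear_combination ((1 - c) ^ (-β) * ((ascPochhammer ℝ k).eval β / k.factorial) *
      (c ^ k / (1 - c) ^ k) * coeff d (g * (U - 1) ^ k)) * hsign
  rw [hvalue]
  simpa only [mul_assoc] using
    (hasSum_weight_mul_choose β hc k).mul_right (coeff d (g * (U - 1) ^ k))

end Weight

section MeixnerPolynomial

theorem binomialSeries_neg_natCast (j : ℕ) :
    PowerSeries.binomialSeries ℝ (-(j : ℝ)) = PowerSeries.binomialSeries ℝ (-1 : ℝ) ^ j := by
  induction j with
  | zero => simp
  | succ j ih =>
    rw [pow_succ, ← ih, ← PowerSeries.binomialSeries_add, Nat.cast_succ, neg_add]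

theorem binomialSeries_neg_one_mul_one_add_X :
    PowerSeries.binomialSeries ℝ (-1 : ℝ) * (1 + PowerSeries.X) = 1 := by
  rw [← pow_one (1 + PowerSeries.X), ← PowerSeries.binomialSeries_nat (R := ℝ),
    ← PowerSeries.binomialSeries_add]
  simp

theorem coeff_one_add_C_mul_X_pow {R : Type*} [CommRing R] (a : R) (n x : ℕ) :
    PowerSeries.coeff n ((1 + PowerSeries.C a * PowerSeries.X) ^ x) = x.choose n * a ^ n := by
  have h : 1 + PowerSeries.C a * PowerSeries.X =
      PowerSeries.rescale a ((1 + Polynomial.X : Polynomial R) : PowerSeries R) := by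
    simp [PowerSeries.rescale_X]
  rw [h, ← map_pow, PowerSeries.coeff_rescale, ← Polynomial.coe_pow, Polynomial.coeff_coe,
    Polynomial.coeff_one_add_X_pow, mul_comm]

/-- The series `(1 + X/c) / (1 + X)`, expanded around its value `1` at `X = 0`. It is the factor of
the generating function `(1 + X/c) ^ x (1 + X) ^ (-x - β)` of the Meixner polynomials that is raised
to the power `x`. -/
noncomputable def ratioSeries (c : ℝ) : PowerSeries ℝ :=
  1 + PowerSeries.C (1 / c - 1) * (PowerSeries.X * PowerSeries.binomialSeries ℝ (-1 : ℝ))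

theorem ratioSeries_mul_one_add_X (c : ℝ) :
    ratioSeries c * (1 + PowerSeries.X) = 1 + PowerSeries.C (1 / c) * PowerSeries.X := by
  rw [ratioSeries, map_sub, map_one]
  linear_combination (PowerSeries.C (1 / c) - 1) * PowerSeries.X *
    binomialSeries_neg_one_mul_one_add_X

theorem constantCoeff_ratioSeries (c : ℝ) :
    PowerSeries.constantCoeff (ratioSeries c) = 1 := by
  simp [ratioSeries]

theorem meixnerPoly_natCast {β : ℝ} (hβ : ∀ k : ℕ, β ≠ -k) (c : ℝ) (k x : ℕ) :
    meixnerPoly k (x : ℝ) β c = k.factorial * ∑ j ∈ Finset.range (k + 1),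
      (x.choose j : ℝ) * (1 - 1 / c) ^ j *
        ((ascPochhammer ℝ (k - j)).eval (β + j) / (k - j).factorial) := by
  rw [meixnerPoly, ordinaryHypergeometric_eq_tsum]
  beta_reduce
  rw [tsum_eq_sum (s := Finset.range (k + 1)), Finset.mul_sum, Finset.mul_sum]
  · refine Finset.sum_congr rfl fun j hj => ?_
    have hjk : j ≤ k := Finset.mem_range_succ_iff.mp hj
    have hne : (ascPochhammer ℝ j).eval β ≠ 0 := by
      rw [Ne, ascPochhammer_eval_eq_zero_iff]
      rintro ⟨i, -, hi⟩
      exact hβ i (by rw [hi, neg_neg])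
    have hsplit := ascPochhammer_eval_add β j (k - j)
    rw [Nat.add_sub_cancel' hjk] at hsplit
    have hsign : ((-1 : ℝ) ^ j) * (-1) ^ j = 1 := by rw [← mul_pow]; simp
    rw [hsplit, ascPochhammer_eval_neg_eq_descPochhammer, ascPochhammer_eval_neg_eq_descPochhammer,
      descPochhammer_eval_natCast, descPochhammer_eval_natCast, Nat.cast_choose ℝ hjk, smul_eq_mul]
    field_simp
    linear_combination ((ascPochhammer ℝ (k - j)).eval (β + j) * x.choose j * (1 - 1 / c) ^ j) *
      hsign
  · intro j hj
    rw [ascPochhammer_eval_neg_coe_nat_of_lt (by simpa using hj)]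
    simp

theorem coeff_binomialSeries_mul_ratioSeries_pow {β : ℝ} (hβ : ∀ k : ℕ, β ≠ -k) (c : ℝ)
    (k x : ℕ) :
    PowerSeries.coeff k (PowerSeries.binomialSeries ℝ (-β) * ratioSeries c ^ x) =
      (-1) ^ k * meixnerPoly k (x : ℝ) β c / k.factorial := by
  have hterm (j : ℕ) : PowerSeries.binomialSeries ℝ (-β) * (ratioSeries c - 1) ^ j =
      PowerSeries.C ((1 / c - 1) ^ j) *
        (PowerSeries.X ^ j * PowerSeries.binomialSeries ℝ (-(β + j))) := by
    rw [ratioSeries, add_sub_cancel_left, neg_add, PowerSeries.binomialSeries_add,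
      binomialSeries_neg_natCast, mul_pow, mul_pow, map_pow]
    ring
  have hexpand : PowerSeries.coeff k (PowerSeries.binomialSeries ℝ (-β) * ratioSeries c ^ x) =
      ∑ j ∈ Finset.range (k + 1), (x.choose j : ℝ) *
        PowerSeries.coeff k (PowerSeries.binomialSeries ℝ (-β) * (ratioSeries c - 1) ^ j) := by
    have h := coeff_mul_pow_eq_sum_choose (constantCoeff_ratioSeries c) x
      (PowerSeries.binomialSeries ℝ (-β)) (Finsupp.single () k)
    rwa [Finsupp.degree_single] at h
  rw [hexpand, meixnerPoly_natCast hβ, mul_left_comm, mul_div_cancel_left₀ _ (by positivity),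
    Finset.mul_sum]
  refine Finset.sum_congr rfl fun j hj => ?_
  have hjk : j ≤ k := Finset.mem_range_succ_iff.mp hj
  have hsign : (-1 : ℝ) ^ k * (1 - 1 / c) ^ j = (-1) ^ (k - j) * (1 / c - 1) ^ j := by
    rw [← neg_sub (1 / c), neg_pow (1 / c - 1), ← mul_assoc, ← pow_add,
      show k + j = k - j + 2 * j by omega, pow_add, pow_mul (-1 : ℝ) 2, neg_one_sq,
      one_pow, mul_one]
  rw [hterm, PowerSeries.coeff_C_mul, PowerSeries.coeff_X_pow_mul',
    if_pos hjk, PowerSeries.binomialSeries_coeff, choose_neg_eq_div, smul_eq_mul, mul_one]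
  linear_combination -(x.choose j : ℝ) *
    ((ascPochhammer ℝ (k - j)).eval (β + j) / (k - j).factorial) * hsign

end MeixnerPolynomial

section Bracket

theorem prod_one_add_C_mul_X_eq_sum_esymm (σ : Type*) {R : Type*} [Fintype σ] [CommSemiring R]
    (a : R) :
    ∏ i : σ, (1 + MvPolynomial.C a * MvPolynomial.X i) =
      ∑ k ∈ Finset.range (Fintype.card σ + 1),
        MvPolynomial.C (a ^ k) * MvPolynomial.esymm σ R k := by
  classical
  rw [Finset.prod_one_add, Finset.sum_powerset, Finset.card_univ]
  refine Finset.sum_congr rfl fun k _ => ?_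
  rw [MvPolynomial.esymm, Finset.mul_sum]
  refine Finset.sum_congr rfl fun t ht => ?_
  rw [Finset.prod_mul_distrib, Finset.prod_const, (Finset.mem_powersetCard.mp ht).2, map_pow]

theorem prod_one_add_C_mul_X_succ (m : ℕ) (a : ℝ) :
    ∏ j : Fin m, (1 + MvPolynomial.C a * MvPolynomial.X j.succ) =
      ∑ k ∈ Finset.range (m + 1), MvPolynomial.C (a ^ k) * elemSymm m k := by
  have h := congrArg (MvPolynomial.rename Fin.succ) (prod_one_add_C_mul_X_eq_sum_esymm (Fin m) a)
  simpa only [elemSymm, map_prod, map_sum, map_add, map_mul, map_one, MvPolynomial.rename_C,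
    MvPolynomial.rename_X, Fintype.card_fin] using h

theorem sum_range_succ_eq_add_sum_Icc_two {M : Type*} [AddCommMonoid M] {g : ℕ → M}
    (hg : g 1 = 0) (m : ℕ) :
    ∑ k ∈ Finset.range (m + 1), g k = g 0 + ∑ k ∈ Finset.Icc 2 m, g k := by
  rw [Finset.range_eq_Ico, Finset.sum_eq_sum_Ico_succ_bot m.succ_pos]
  refine congrArg (g 0 + ·) (Finset.sum_subset (fun k hk => ?_) fun k hk hk' => ?_).symm
  · simp only [Finset.mem_Icc, Finset.mem_Ico] at hk ⊢
    omega
  · simp only [Finset.mem_Icc, Finset.mem_Ico] at hk hk'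
    rw [show k = 1 by omega, hg]

-- The coefficient of `e_k` in the bracket would be `-1` for `k = 0` and `0` for `k = 1`, so the sum
-- may be started at `k = 0` and absorbs the constant term.
theorem bracket_eq_neg_sum (m : ℕ) {c : ℝ} (hc0 : c ≠ 0) (hc1 : c ≠ 1) :
    bracket m c = -∑ k ∈ Finset.range (m + 1),
        MvPolynomial.C ((1 - c ^ (1 - (k : ℤ))) / (c * (1 - c⁻¹))) * elemSymm m k
      - MvPolynomial.X 0 * ∏ j : Fin m, (1 + MvPolynomial.C (1 / c) * MvPolynomial.X j.succ) := by
  have hden : c * (1 - c⁻¹) = c - 1 := by field_simp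
  have hzero : (1 - c) / (c - 1) = -1 := by
    rw [← neg_sub c, neg_div, div_self (sub_ne_zero.mpr hc1)]
  rw [bracket, sum_range_succ_eq_add_sum_Icc_two (by simp), neg_add, hden]
  simp [elemSymm, hzero]
  ring

theorem C_mul_bracket (m : ℕ) {c : ℝ} (hc0 : c ≠ 0) (hc1 : c ≠ 1) :
    MvPolynomial.C (1 - c) * bracket m c =
      ∏ j : Fin m, (1 + MvPolynomial.X j.succ) -
        MvPolynomial.C c * ((1 + MvPolynomial.C ((1 - c) / c) * MvPolynomial.X 0) *
          ∏ j : Fin m, (1 + MvPolynomial.C (1 / c) * MvPolynomial.X j.succ)) := by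
  have hcoeff (k : ℕ) :
      (1 - c) * ((1 - c ^ (1 - (k : ℤ))) / (c * (1 - c⁻¹))) = c * (1 / c) ^ k - 1 := by
    have hc1' : c - 1 ≠ 0 := sub_ne_zero.mpr hc1
    rw [show c * (1 - c⁻¹) = c - 1 by field_simp, zpow_sub₀ hc0, zpow_one, zpow_natCast, one_div,
      inv_pow]
    field_simp
    ring
  have hone := prod_one_add_C_mul_X_succ m 1
  have hsum : MvPolynomial.C (1 - c) * ∑ k ∈ Finset.range (m + 1),
      MvPolynomial.C ((1 - c ^ (1 - (k : ℤ))) / (c * (1 - c⁻¹))) * elemSymm m k =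
      MvPolynomial.C c * ∏ j : Fin m, (1 + MvPolynomial.C (1 / c) * MvPolynomial.X j.succ) -
        ∏ j : Fin m, (1 + MvPolynomial.X j.succ) := by
    simp only [one_pow, map_one, one_mul] at hone
    rw [hone, prod_one_add_C_mul_X_succ, Finset.mul_sum, Finset.mul_sum, ← Finset.sum_sub_distrib]
    refine Finset.sum_congr rfl fun k _ => ?_
    rw [← mul_assoc, ← map_mul, hcoeff, map_sub, map_mul, map_one]
    ring
  have hC : (MvPolynomial.C c * MvPolynomial.C ((1 - c) / c) : MvPolynomial (Fin (m + 1)) ℝ) =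
      MvPolynomial.C (1 - c) := by
    rw [← map_mul, mul_div_cancel₀ _ hc0]
  rw [bracket_eq_neg_sum m hc0 hc1]
  linear_combination -hsum + MvPolynomial.X 0 *
    (∏ j : Fin m, (1 + MvPolynomial.C (1 / c) * MvPolynomial.X j.succ)) * hC

end Bracket

section GeneratingFunction

variable {m : ℕ} {β c : ℝ}

/-- The factor `∏ j, (1 + x_j) ^ (-β)` of the generating function of the summands of `B` that does
not depend on the summation variable. -/
noncomputable def baseSeries (m : ℕ) (β : ℝ) : MvPowerSeries (Fin (m + 1)) ℝ :=
  ∏ j : Fin m, (PowerSeries.binomialSeries ℝ (-β)).subst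
    (MvPowerSeries.X j.succ : MvPowerSeries (Fin (m + 1)) ℝ)

/-- The factor `(1 + (1 - c) x₀ / c) ∏ j, (1 + x_j / c) / (1 + x_j)` of the generating function of
the summands of `B` that is raised to the summation variable. -/
noncomputable def powSeries (m : ℕ) (c : ℝ) : MvPowerSeries (Fin (m + 1)) ℝ :=
  (1 + MvPowerSeries.C ((1 - c) / c) * MvPowerSeries.X 0) *
    ∏ j : Fin m, (ratioSeries c).subst (MvPowerSeries.X j.succ : MvPowerSeries (Fin (m + 1)) ℝ)

theorem constantCoeff_powSeries (m : ℕ) (c : ℝ) : constantCoeff (powSeries m c) = 1 := by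
  simp [powSeries, map_prod, constantCoeff_subst_X, constantCoeff_ratioSeries]

theorem baseSeries_mul_powSeries_pow (m : ℕ) (β c : ℝ) (x : ℕ) :
    baseSeries m β * powSeries m c ^ x =
      ∏ i, PowerSeries.subst (MvPowerSeries.X i : MvPowerSeries (Fin (m + 1)) ℝ)
        ((Fin.cons ((1 + PowerSeries.C ((1 - c) / c) * PowerSeries.X) ^ x) fun _ =>
          PowerSeries.binomialSeries ℝ (-β) * ratioSeries c ^ x :
            Fin (m + 1) → PowerSeries ℝ) i) := by
  have hs (i : Fin (m + 1)) :
      PowerSeries.HasSubst (MvPowerSeries.X i : MvPowerSeries (Fin (m + 1)) ℝ) := .X i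
  rw [Fin.prod_univ_succ]
  simp only [Fin.cons_zero, Fin.cons_succ, PowerSeries.subst_mul (hs _),
    PowerSeries.subst_pow (hs _), subst_X_one_add_C_mul_X]
  rw [baseSeries, powSeries, mul_pow, ← Finset.prod_pow, mul_left_comm, Finset.prod_mul_distrib]

theorem weight_mul_coeff (hβ : ∀ k : ℕ, β ≠ -k) (c : ℝ) (d : Fin (m + 1) →₀ ℕ) (x : ℕ) :
    weight β c x * coeff d (baseSeries m β * powSeries m c ^ x) =
      (-1) ^ (∑ j : Fin m, d j.succ) * ((1 - c) / c) ^ d 0 *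
        summand β c (d 0) (fun j : Fin m => d j.succ) x / ∏ i, ((d i).factorial : ℝ) := by
  rw [baseSeries_mul_powSeries_pow, coeff_prod_subst_X, Fin.prod_univ_succ, Fin.prod_univ_succ]
  simp only [Fin.cons_zero, Fin.cons_succ, coeff_one_add_C_mul_X_pow,
    coeff_binomialSeries_mul_ratioSeries_pow hβ]
  rw [Finset.prod_div_distrib, Finset.prod_mul_distrib, Finset.prod_pow_eq_pow_sum, summand,
    descPochhammer_eval_natCast, weight]
  field_simp

theorem baseSeries_eq_seriesPow (m : ℕ) (β : ℝ) :
    baseSeries m β = seriesPow (∏ j : Fin m, (1 + MvPowerSeries.X j.succ)) (-β) := by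
  rw [baseSeries, seriesPow_prod _ fun j _ => by simp]
  simp only [seriesPow, add_sub_cancel_left]

theorem powSeries_mul_prod (m : ℕ) (c : ℝ) :
    powSeries m c * ∏ j : Fin m, (1 + MvPowerSeries.X j.succ) =
      (1 + MvPowerSeries.C ((1 - c) / c) * MvPowerSeries.X 0) *
        ∏ j : Fin m, (1 + MvPowerSeries.C (1 / c) * MvPowerSeries.X j.succ) := by
  rw [powSeries, mul_assoc, ← Finset.prod_mul_distrib]
  refine congrArg _ (Finset.prod_congr rfl fun j _ => ?_)
  have h := subst_X_one_add_C_mul_X (1 : ℝ) j.succ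
  rw [map_one, map_one, one_mul, one_mul] at h
  rw [← h, ← PowerSeries.subst_mul (.X j.succ), ratioSeries_mul_one_add_X, subst_X_one_add_C_mul_X]

theorem coe_bracket (m : ℕ) (hc0 : c ≠ 0) (hc1 : c ≠ 1) :
    (bracket m c : MvPowerSeries (Fin (m + 1)) ℝ) =
      (∏ j : Fin m, (1 + MvPowerSeries.X j.succ)) *
        (1 - MvPowerSeries.C (c / (1 - c)) * (powSeries m c - 1)) := by
  have hc : 1 - c ≠ 0 := sub_ne_zero.mpr hc1.symm
  have hC : (MvPowerSeries.C (1 - c) * MvPowerSeries.C (c / (1 - c)) :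
      MvPowerSeries (Fin (m + 1)) ℝ) = MvPowerSeries.C c := by
    rw [← map_mul, mul_div_cancel₀ _ hc]
  have hC' : (MvPowerSeries.C (1 - c) : MvPowerSeries (Fin (m + 1)) ℝ) =
      1 - MvPowerSeries.C c := by rw [map_sub, map_one]
  have h := congrArg (MvPolynomial.coeToMvPowerSeries.ringHom (R := ℝ)) (C_mul_bracket m hc0 hc1)
  simp only [map_mul, map_sub (MvPolynomial.coeToMvPowerSeries.ringHom (R := ℝ)), map_prod, map_add,
    map_one, MvPolynomial.coeToMvPowerSeries.ringHom_apply, MvPolynomial.coe_C,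
    MvPolynomial.coe_X] at h
  rw [← powSeries_mul_prod] at h
  refine mul_left_cancel₀ (MvPowerSeries.C_injective.ne_iff' (map_zero _) |>.mpr hc) ?_
  set P : MvPowerSeries (Fin (m + 1)) ℝ := ∏ j : Fin m, (1 + MvPowerSeries.X j.succ)
  linear_combination h + P * (powSeries m c - 1) * hC - P * hC'

theorem seriesPow_bracket (m : ℕ) (hc0 : c ≠ 0) (hc1 : c ≠ 1) (β : ℝ) :
    seriesPow (bracket m c : MvPowerSeries (Fin (m + 1)) ℝ) (-β) = baseSeries m β *
      seriesPow (1 - MvPowerSeries.C (c / (1 - c)) * (powSeries m c - 1)) (-β) := by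
  rw [coe_bracket m hc0 hc1, seriesPow_mul (by simp [map_prod]) (by simp [constantCoeff_powSeries]),
    baseSeries_eq_seriesPow]

theorem hasSum_summand (hβ : ∀ k : ℕ, β ≠ -k) (hc0 : c ≠ 0) (hc1 : |c| < 1)
    (d : Fin (m + 1) →₀ ℕ) :
    HasSum (fun x => (-1) ^ (∑ j : Fin m, d j.succ) * ((1 - c) / c) ^ d 0 *
        summand β c (d 0) (fun j : Fin m => d j.succ) x / ∏ i, ((d i).factorial : ℝ))
      ((1 - c) ^ (-β) *
        coeff d (seriesPow (bracket m c : MvPowerSeries (Fin (m + 1)) ℝ) (-β))) := by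
  rw [seriesPow_bracket m hc0 (abs_lt.mp hc1).2.ne]
  simpa only [weight_mul_coeff hβ] using
    hasSum_weight_mul_coeff_mul_pow β hc1 (constantCoeff_powSeries m c) (baseSeries m β) d

theorem summable_summand (hβ : ∀ k : ℕ, β ≠ -k) (hc0 : c ≠ 0) (hc1 : |c| < 1)
    (n₀ : ℕ) (n : Fin m → ℕ) : Summable (summand β c n₀ n) := by
  have h := (hasSum_summand hβ hc0 hc1
    (Finsupp.equivFunOnFinite.symm (Fin.cons n₀ n : Fin (m + 1) → ℕ))).summable
  have hc : 1 - c ≠ 0 := (sub_pos.mpr (abs_lt.mp hc1).2).ne'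
  simp only [Finsupp.equivFunOnFinite_symm_apply_apply, Fin.cons_zero, Fin.cons_succ,
    div_eq_mul_inv (_ * _)] at h
  rwa [summable_mul_right_iff (by positivity), summable_mul_left_iff (by positivity)] at h

theorem genFun_eq_seriesPow_bracket (m : ℕ) (hβ : ∀ k : ℕ, β ≠ -k) (hc0 : c ≠ 0)
    (hc1 : |c| < 1) :
    genFun m β c = seriesPow (bracket m c : MvPowerSeries (Fin (m + 1)) ℝ) (-β) := by
  have hc : 0 < 1 - c := sub_pos.mpr (abs_lt.mp hc1).2
  ext d
  have hsum := (hasSum_summand hβ hc0 hc1 d).tsum_eq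
  rw [tsum_div_const, tsum_mul_left] at hsum
  calc coeff d (genFun m β c)
      = B β c (d 0) (fun j : Fin m => d j.succ) / ∏ i, ((d i).factorial : ℝ) := rfl
    _ = (1 - c) ^ β * ((1 - c) ^ (-β) *
          coeff d (seriesPow (bracket m c : MvPowerSeries (Fin (m + 1)) ℝ) (-β))) := by
        rw [← hsum, B, Real.rpow_add hc, Real.rpow_natCast, div_pow]
        ring
    _ = _ := by rw [← mul_assoc, ← Real.rpow_add hc, add_neg_cancel, Real.rpow_zero, one_mul]

end GeneratingFunction

section Cycles

open Equiv.Perm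

variable {α : Type*} [Fintype α] [DecidableEq α] (π : Equiv.Perm α)

/-- A label of the cycle through `a`: the cyclic permutation, or `a` itself if `a` is fixed. Two
points have the same label exactly when they lie on the same cycle, so `cyc π` labels occur. -/
def cycleLabel (a : α) : Equiv.Perm α ⊕ α :=
  if π a = a then .inr a else .inl (π.cycleOf a)

variable {π} in
theorem cycleLabel_eq_iff {a b : α} : cycleLabel π a = cycleLabel π b ↔ π.SameCycle a b := by
  unfold cycleLabel
  split_ifs with ha hb hb
  · rw [Sum.inr.injEq]
    exact ⟨fun h => h.sameCycle π, fun h => h.eq_of_left ha⟩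
  · exact iff_of_false id fun h => hb (h.apply_eq_self_iff.mp ha)
  · exact iff_of_false id fun h => ha (h.apply_eq_self_iff.mpr hb)
  · rw [Sum.inl.injEq, sameCycle_iff_cycleOf_eq_of_mem_support (mem_support.mpr ha)
      (mem_support.mpr hb)]

theorem range_cycleLabel :
    Set.range (cycleLabel π) =
      π.cycleFactorsFinset.disjSum (Finset.univ.filter fun a => π a = a) := by
  ext y
  rw [Finset.mem_coe]
  refine ⟨?_, fun hy => ?_⟩
  · rintro ⟨a, rfl⟩
    unfold cycleLabel
    split_ifs with ha
    · simpa using ha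
    · simpa [cycleOf_mem_cycleFactorsFinset_iff] using ha
  · rcases Finset.mem_disjSum.mp hy with ⟨σ, hσ, rfl⟩ | ⟨a, ha, rfl⟩
    · obtain ⟨a, ha⟩ := (mem_cycleFactorsFinset_iff.mp hσ).1.nonempty_support
      have hne : π a ≠ a := mem_support.mp (mem_cycleFactorsFinset_support_le hσ ha)
      exact ⟨a, by rw [cycleLabel, if_neg hne, cycle_is_cycleOf ha hσ]⟩
    · exact ⟨a, if_pos (Finset.mem_filter.mp ha).2⟩

theorem card_quotient_ker_cycleLabel :
    Nat.card (Quotient (Setoid.ker (cycleLabel π))) = cyc π := by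
  rw [Nat.card_congr (Setoid.quotientKerEquivRange (cycleLabel π)), Nat.card_coe_set_eq,
    range_cycleLabel, Set.ncard_coe_finset, Finset.card_disjSum, cyc, cycleType_def,
    Multiset.card_map]
  rfl

variable {π} in
theorem ker_cycleLabel_le_ker_iff {K : Type*} {g : α → K} :
    Setoid.ker (cycleLabel π) ≤ Setoid.ker g ↔ ∀ a, g a = g (π a) := by
  refine ⟨fun h a => h (cycleLabel_eq_iff.mpr (sameCycle_apply_right.mpr SameCycle.rfl)), ?_⟩
  intro h a b hab
  obtain ⟨n, rfl⟩ := (cycleLabel_eq_iff.mp hab).exists_nat_pow_eq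
  clear hab
  induction n with
  | zero => rfl
  | succ n ih => exact ih.trans (by rw [h, pow_succ', mul_apply])

theorem card_invariant_colorings (K : Type*) [Fintype K] [DecidableEq K] :
    (Finset.univ.filter fun g : α → K => ∀ a, g a = g (π a)).card = Fintype.card K ^ cyc π := by
  rw [← Fintype.card_subtype, ← Nat.card_eq_fintype_card, ← Nat.card_eq_fintype_card (α := K),
    ← card_quotient_ker_cycleLabel, ← Nat.card_fun]
  exact Nat.card_congr <| (Equiv.subtypeEquivRight fun _ => ker_cycleLabel_le_ker_iff.symm).trans
    (Setoid.liftEquiv _)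

theorem neg_one_pow_cyc (R : Type*) [CommRing R] :
    (-1 : R) ^ cyc π = (-1) ^ Fintype.card α * ((sign π : ℤ) : R) := by
  have hcard : (Finset.univ.filter fun a => π a = a).card + π.support.card = Fintype.card α :=
    Finset.card_filter_add_card_filter_not (s := Finset.univ) fun a => π a = a
  have hsq : (-1 : R) ^ π.support.card * (-1) ^ π.support.card = 1 :=
    pow_mul_pow_eq_one _ (by rw [neg_one_mul, neg_neg])
  rw [sign_of_cycleType, sum_cycleType, ← hcard, cyc]
  push_cast
  rw [pow_add, pow_add, pow_add]
  linear_combination (-((-1 : R) ^ π.cycleType.card *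
    (-1) ^ (Finset.univ.filter fun a => π a = a).card)) * hsq

end Cycles

section Polarization

variable {I K R : Type*} [DecidableEq K] [CommRing R]

theorem pderiv_prod (i : I) (t : Finset K) (F : K → MvPolynomial I R) :
    MvPolynomial.pderiv i (∏ k ∈ t, F k) =
      ∑ k₀ ∈ t, ∏ k ∈ t, Function.update F k₀ (MvPolynomial.pderiv i (F k₀)) k := by
  induction t using Finset.induction_on with
  | empty => simp
  | insert a t ha ih =>
    have ne_of_mem {k : K} (hk : k ∈ t) : k ≠ a := fun h => ha (h ▸ hk)
    rw [Finset.prod_insert ha, Derivation.leibniz, ih, Finset.sum_insert ha,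
      Finset.prod_insert ha, Function.update_self, smul_eq_mul, smul_eq_mul, Finset.mul_sum,
      add_comm, mul_comm]
    refine congrArg₂ _ (congrArg _ (Finset.prod_congr rfl fun k hk => ?_))
      (Finset.sum_congr rfl fun k₀ hk₀ => ?_)
    · rw [Function.update_of_ne (ne_of_mem hk)]
    · rw [Finset.prod_insert ha, Function.update_of_ne (ne_of_mem hk₀).symm]

/-- The values, with multiplicity, that `f` takes on the color class of `g` of color `k`: when the
derivatives along the variables `f a` are distributed over a product of factors by a map `g`, these
are the variables along which the factor `k` is differentiated. -/
def fiberValues {α : Type*} [Fintype α] (f : α → I) (g : α → K) (k : K) : Multiset I :=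
  ((Finset.univ : Finset α).val.filter fun a => g a = k).map f

theorem fiberValues_comp_equiv {α γ : Type*} [Fintype α] [Fintype γ] (e : γ ≃ α) (f : α → I)
    (g : α → K) (k : K) : fiberValues (f ∘ e) (g ∘ e) k = fiberValues f g k := by
  rw [fiberValues, fiberValues, ← Multiset.map_univ_val_equiv e, Multiset.filter_map,
    Multiset.map_map]
  rfl

theorem fiberValues_eq_map_restrict {α : Type*} [Fintype α] (f : α → I) (g : α → K) (k : K) :
    fiberValues f g k = Finset.univ.val.map (Subtype.restrict (fun a => g a = k) f) :=
  (Finset.univ_val_map_subtype_restrict f _).symm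

theorem fiberValues_cons {n : ℕ} (f : Fin (n + 1) → I) (k₀ : K) (g : Fin n → K) (k : K) :
    fiberValues f (Fin.cons k₀ g : Fin (n + 1) → K) k =
      if k₀ = k then f 0 ::ₘ fiberValues (fun a => f a.succ) g k
      else fiberValues (fun a => f a.succ) g k := by
  simp only [fiberValues, Fin.univ_succ, Finset.cons_val, Finset.map_val, Multiset.filter_cons,
    Multiset.filter_map, Fin.cons_zero]
  split_ifs <;> simp

variable [Fintype I] [DecidableEq I]

/-- The iterated partial derivative of `F` along the variables in `s`, evaluated at `0`. It is
defined through the coefficient of the monomial `s`, so that no order of the derivatives has to be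
chosen. -/
noncomputable def derivAtZero (s : Multiset I) (F : MvPolynomial I R) : R :=
  (∏ i, ((s.count i).factorial : R)) * MvPolynomial.coeff (Multiset.toFinsupp s) F

theorem derivAtZero_zero (F : MvPolynomial I R) :
    derivAtZero 0 F = MvPolynomial.constantCoeff F := by
  simp [derivAtZero, MvPolynomial.constantCoeff_eq]

theorem derivAtZero_cons (i : I) (s : Multiset I) (F : MvPolynomial I R) :
    derivAtZero (i ::ₘ s) F = derivAtZero s (MvPolynomial.pderiv i F) := by
  have hfact : (∏ j, (((i ::ₘ s).count j).factorial : R)) =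
      (s.count i + 1) * ∏ j, ((s.count j).factorial : R) := by
    rw [← Finset.mul_prod_erase _ _ (Finset.mem_univ i),
      ← Finset.mul_prod_erase (a := i) Finset.univ (fun j => ((s.count j).factorial : R))
        (Finset.mem_univ i), Multiset.count_cons_self, Nat.factorial_succ, ← mul_assoc]
    push_cast
    refine congrArg _ (Finset.prod_congr rfl fun j hj => ?_)
    rw [Multiset.count_cons_of_ne (Finset.ne_of_mem_erase hj)]
  rw [derivAtZero, derivAtZero, MvPolynomial.coeff_pderiv, hfact, Multiset.toFinsupp_apply,
    ← Multiset.singleton_add, Multiset.toFinsupp_add, Multiset.toFinsupp_singleton,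
    add_comm (Finsupp.single i 1)]
  ring

theorem derivAtZero_C_mul (s : Multiset I) (a : R) (F : MvPolynomial I R) :
    derivAtZero s (MvPolynomial.C a * F) = a * derivAtZero s F := by
  simp [derivAtZero, mul_left_comm]

theorem derivAtZero_sum {L : Type*} (s : Multiset I) (t : Finset L) (F : L → MvPolynomial I R) :
    derivAtZero s (∑ k ∈ t, F k) = ∑ k ∈ t, derivAtZero s (F k) := by
  simp [derivAtZero, MvPolynomial.coeff_sum, Finset.mul_sum]

theorem derivAtZero_prod_X (s : Multiset I) (t : Finset I) :
    derivAtZero s (∏ i ∈ t, MvPolynomial.X i : MvPolynomial I R) = if t.val = s then 1 else 0 := by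
  have hmon : (∏ i ∈ t, MvPolynomial.X i : MvPolynomial I R) =
      MvPolynomial.monomial (Multiset.toFinsupp t.val) 1 := by
    rw [Multiset.toFinsupp_eq_iff.mpr
      (by rw [Finsupp.toMultiset_sum_single, one_smul] : t.val = Finsupp.toMultiset
        (∑ i ∈ t, Finsupp.single i 1)), MvPolynomial.monomial_sum_one]
    rfl
  rw [derivAtZero, hmon, MvPolynomial.coeff_monomial, mul_ite, mul_one, mul_zero]
  refine if_ctx_congr Multiset.toFinsupp.injective.eq_iff (fun h => ?_) fun _ => rfl
  refine Finset.prod_eq_one fun i _ => ?_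
  have hle := Multiset.nodup_iff_count_le_one.mp (h ▸ t.nodup) i
  rw [Nat.factorial_eq_one.mpr hle, Nat.cast_one]

theorem derivAtZero_prod_fin [Fintype K] {n : ℕ} (f : Fin n → I) (F : K → MvPolynomial I R) :
    derivAtZero (Finset.univ.val.map f) (∏ k, F k) =
      ∑ g : Fin n → K, ∏ k, derivAtZero (fiberValues f g k) (F k) := by
  induction n generalizing F with
  | zero => simp [fiberValues, derivAtZero_zero, map_prod]
  | succ n ih =>
    have huniv : (Finset.univ : Finset (Fin (n + 1))).val.map f =
        f 0 ::ₘ (Finset.univ : Finset (Fin n)).val.map fun a => f a.succ := by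
      simp [Fin.univ_succ, Function.comp_def]
    rw [huniv, derivAtZero_cons, pderiv_prod, derivAtZero_sum,
      ← (Fin.consEquiv fun _ : Fin (n + 1) => K).sum_comp, Fintype.sum_prod_type]
    refine Finset.sum_congr rfl fun k₀ _ => ?_
    rw [ih]
    refine Finset.sum_congr rfl fun g _ => Finset.prod_congr rfl fun k _ => ?_
    rw [Fin.consEquiv, Equiv.coe_fn_mk, fiberValues_cons]
    split_ifs with hk
    · rw [← hk, derivAtZero_cons, Function.update_self]
    · rw [Function.update_of_ne (Ne.symm hk)]

theorem derivAtZero_prod {α : Type*} [Fintype α] [DecidableEq α] [Fintype K] (f : α → I)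
    (F : K → MvPolynomial I R) :
    derivAtZero (Finset.univ.val.map f) (∏ k, F k) =
      ∑ g : α → K, ∏ k, derivAtZero (fiberValues f g k) (F k) := by
  let e := (Fintype.equivFin α).symm
  rw [← Multiset.map_univ_val_equiv e, Multiset.map_map, derivAtZero_prod_fin,
    ← (e.symm.arrowCongr (Equiv.refl K)).sum_comp]
  refine Finset.sum_congr rfl fun g _ => Finset.prod_congr rfl fun k _ => ?_
  rw [← fiberValues_comp_equiv e]
  rfl

end Polarization

section MacMahon

variable {I R : Type*} [Fintype I] [DecidableEq I] [CommRing R]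

theorem det_one_add_diagonal_mul (d : I → R) (A : Matrix I I R) :
    (1 + Matrix.diagonal d * A).det =
      ∑ S : Finset I, (∏ i ∈ S, d i) * (A.submatrix (↑) (↑) : Matrix S S R).det := by
  have hpiecewise (S : Finset I) :
      S.piecewise (Matrix.diagonal d * A).row (1 : Matrix I I R).row =
        fun i => (if i ∈ S then d i else 1) • S.piecewise A.row (1 : Matrix I I R).row i := by
    ext i j
    by_cases hi : i ∈ S <;> simp [hi, Matrix.diagonal_mul]
  calc (1 + Matrix.diagonal d * A).det
      = Matrix.detRowAlternating ((Matrix.diagonal d * A).row + (1 : Matrix I I R).row) := by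
        rw [add_comm]
        rfl
    _ = ∑ S : Finset I, Matrix.detRowAlternating
          (S.piecewise (Matrix.diagonal d * A).row (1 : Matrix I I R).row) :=
        Matrix.detRowAlternating.map_add_univ _ _
    _ = _ := by
        refine Finset.sum_congr rfl fun S _ => ?_
        rw [hpiecewise, AlternatingMap.map_smul_univ, Fintype.prod_ite_mem, smul_eq_mul,
          ← Matrix.det_piecewise_one_eq_submatrix_det]
        rfl

/-- The polynomial `det (1 - diag(x_i) * W)`. MacMahon's master theorem and its extension by a
parameter `β` express the coefficients of its powers through permutations weighted by `W`. -/
noncomputable def macMahonDet (W : Matrix I I R) : MvPolynomial I R :=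
  (1 - Matrix.diagonal MvPolynomial.X * W.map MvPolynomial.C).det

theorem constantCoeff_macMahonDet (W : Matrix I I R) :
    MvPolynomial.constantCoeff (macMahonDet W) = 1 := by
  rw [macMahonDet, RingHom.map_det]
  refine (congrArg _ ?_).trans Matrix.det_one
  ext i j
  rcases eq_or_ne i j with rfl | h
  · simp
  · simp [h]

theorem macMahonDet_eq_sum_minors (W : Matrix I I R) :
    macMahonDet W = ∑ S : Finset I, MvPolynomial.C
      ((-1) ^ S.card * (W.submatrix (↑) (↑) : Matrix S S R).det) * ∏ i ∈ S, MvPolynomial.X i := by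
  have hneg : 1 - Matrix.diagonal MvPolynomial.X * W.map MvPolynomial.C =
      1 + Matrix.diagonal (fun i => -MvPolynomial.X i) *
        W.map (MvPolynomial.C : R →+* MvPolynomial I R) := by
    ext i j
    simp [sub_eq_add_neg]
  rw [macMahonDet, hneg, det_one_add_diagonal_mul]
  refine Finset.sum_congr rfl fun S _ => ?_
  rw [Finset.prod_neg, map_mul, map_pow, map_neg, map_one, RingHom.map_det, mul_right_comm]
  rfl

theorem derivAtZero_macMahonDet {α : Type*} [Fintype α] [DecidableEq α] (W : Matrix I I R)
    (f : α → I) :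
    derivAtZero (Finset.univ.val.map f) (macMahonDet W) =
      (-1) ^ Fintype.card α * (W.submatrix f f).det := by
  simp only [macMahonDet_eq_sum_minors, derivAtZero_sum, derivAtZero_C_mul, derivAtZero_prod_X,
    mul_ite, mul_one, mul_zero]
  by_cases hf : Function.Injective f
  · let S : Finset I := Finset.univ.map ⟨f, hf⟩
    let e : α ≃ S := (Equiv.ofInjective f hf).trans (Equiv.setCongr (by simp [S]))
    have hS : Finset.univ.val.map f = S.val := rfl
    simp only [hS, Finset.val_inj, Finset.sum_ite_eq', Finset.mem_univ, if_true]
    rw [Finset.card_map, Finset.card_univ, ← Matrix.det_submatrix_equiv_self e]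
    rfl
  · obtain ⟨a, b, hab, hne⟩ := Function.not_injective_iff.mp hf
    rw [Matrix.det_zero_of_row_eq hne (by ext j; simp [hab]), mul_zero]
    refine Finset.sum_eq_zero fun T _ => if_neg fun hT => hf ?_
    have hnodup : (Finset.univ.val.map f).Nodup := hT ▸ T.nodup
    exact fun a b => Multiset.inj_on_of_nodup_map hnodup a (Finset.mem_univ a) b (Finset.mem_univ b)

theorem det_of_ite_color {α K : Type*} [Fintype α] [DecidableEq α] [Fintype K]
    [LinearOrder K] (g : α → K) (A : Matrix α α R) :
    (Matrix.of fun a b => if g a = g b then A a b else 0).det =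
      ∏ k, (A.submatrix (↑) (↑) : Matrix {a // g a = k} {a // g a = k} R).det := by
  rw [Matrix.BlockTriangular.det_fintype (b := g) fun a b hab => by simp [hab.ne']]
  refine Finset.prod_congr rfl fun k _ => congrArg _ ?_
  ext a b
  simp [Matrix.toSquareBlock_def, a.2, b.2]

theorem sum_perm_neg_natCast_pow_cyc {α : Type*} [Fintype α] [DecidableEq α] (W : Matrix I I R)
    (f : α → I) (N : ℕ) :
    ∑ π : Equiv.Perm α, (-(N : R)) ^ cyc π * ∏ a, W (f a) (f (π a)) =
      derivAtZero (Finset.univ.val.map f) (macMahonDet W ^ N) := by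
  have hsign (π : Equiv.Perm α) :
      (-(N : R)) ^ cyc π = ∑ g : α → Fin N, if ∀ a, g a = g (π a) then
        (-1) ^ Fintype.card α * ((Equiv.Perm.sign π : ℤ) : R) else 0 := by
    rw [← Finset.sum_filter, Finset.sum_const, card_invariant_colorings, Fintype.card_fin,
      ← neg_one_pow_cyc, nsmul_eq_mul, Nat.cast_pow, neg_pow, mul_comm]
  have hcard (g : α → Fin N) : ∑ k, Fintype.card {a // g a = k} = Fintype.card α := by
    rw [← Fintype.card_sigma]
    exact Fintype.card_congr (Equiv.sigmaFiberEquiv g)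
  symm
  calc derivAtZero (Finset.univ.val.map f) (macMahonDet W ^ N)
      = ∑ g : α → Fin N, ∏ k, derivAtZero (fiberValues f g k) (macMahonDet W) := by
        rw [← derivAtZero_prod, Finset.prod_const, Finset.card_univ, Fintype.card_fin]
    _ = ∑ g : α → Fin N, (-1) ^ Fintype.card α *
          (Matrix.of fun a b => if g a = g b then W (f a) (f b) else 0).det := by
        refine Finset.sum_congr rfl fun g _ => ?_
        simp only [fiberValues_eq_map_restrict, derivAtZero_macMahonDet, Finset.prod_mul_distrib,
          Finset.prod_pow_eq_pow_sum, hcard]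
        exact congrArg _ (det_of_ite_color g (W.submatrix f f)).symm
    _ = ∑ g : α → Fin N, ∑ π : Equiv.Perm α, (if ∀ a, g a = g (π a) then
          (-1) ^ Fintype.card α * ((Equiv.Perm.sign π : ℤ) : R) else 0) *
            ∏ a, W (f a) (f (π a)) := by
        refine Finset.sum_congr rfl fun g _ => ?_
        rw [← Matrix.det_transpose, Matrix.det_apply', Finset.mul_sum]
        refine Finset.sum_congr rfl fun π _ => ?_
        simp only [Matrix.transpose_apply, Matrix.of_apply, Fintype.prod_ite_zero]
        split_ifs <;> ring
    _ = _ := by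
        rw [Finset.sum_comm]
        exact Finset.sum_congr rfl fun π _ => by rw [← Finset.sum_mul, hsign]

theorem sum_perm_pow_cyc {α : Type*} [Fintype α] [DecidableEq α] (W : Matrix I I ℝ) (f : α → I)
    (β : ℝ) :
    ∑ π : Equiv.Perm α, β ^ cyc π * ∏ a, W (f a) (f (π a)) =
      (∏ i, (((Finset.univ.val.map f).count i).factorial : ℝ)) *
        coeff (Multiset.toFinsupp (Finset.univ.val.map f))
          (seriesPow (macMahonDet W : MvPowerSeries I ℝ) (-β)) := by
  set s := (Finset.univ : Finset α).val.map f
  have hconst : constantCoeff (macMahonDet W : MvPowerSeries I ℝ) = 1 := by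
    rw [← MvPowerSeries.coeff_zero_eq_constantCoeff_apply, MvPolynomial.coeff_coe,
      ← MvPolynomial.constantCoeff_eq, constantCoeff_macMahonDet]
  obtain ⟨p, hp⟩ := isPolyFamily_seriesPow hconst (Multiset.toFinsupp s)
  let q : Polynomial ℝ := ∑ π : Equiv.Perm α, (-.X) ^ cyc π * .C (∏ a, W (f a) (f (π a)))
  have hq (r : ℝ) : q.eval r = ∑ π : Equiv.Perm α, (-r) ^ cyc π * ∏ a, W (f a) (f (π a)) := by
    simp only [q, Polynomial.eval_finsetSum, Polynomial.eval_mul, Polynomial.eval_C,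
      Polynomial.eval_pow, Polynomial.eval_neg, Polynomial.eval_X]
  have hqp : q = .C (∏ i, ((s.count i).factorial : ℝ)) * p := by
    refine polynomial_eq_of_eval_natCast fun N => ?_
    rw [hq, sum_perm_neg_natCast_pow_cyc, Polynomial.eval_mul, Polynomial.eval_C, hp,
      seriesPow_natCast hconst, ← MvPolynomial.coe_pow, MvPolynomial.coeff_coe, derivAtZero]
  rw [← hp, ← Polynomial.eval_C_mul, ← hqp, hq, neg_neg]

end MacMahon
section StepWeight

theorem exists_det_add_smul_vecMulVec {ι R : Type*} [Fintype ι] [DecidableEq ι] [CommRing R]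
    (M : Matrix ι ι R) (u v : ι → R) :
    ∃ b : R, ∀ t : R, (M + t • Matrix.vecMulVec u v).det = M.det + t * b := by
  let N : Matrix (ι ⊕ Unit) (ι ⊕ Unit) R := Matrix.fromBlocks M 0 (Matrix.replicateRow Unit v) 0
  let e : ι ⊕ Unit → R := Sum.elim 0 1
  let w : ι ⊕ Unit → R := Sum.elim (-u) 0
  have hbordered (t : R) : (M + t • Matrix.vecMulVec u v).det =
      (N.updateCol (.inr ()) e).det +
        t * (N.updateCol (.inr ()) w).det := by
    have hN : N.updateCol (.inr ()) (e + t • w) =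
        Matrix.fromBlocks M (Matrix.replicateCol Unit (-t • u)) (Matrix.replicateRow Unit v) 1 := by
      ext (i | i) (j | j) <;> simp [N, e, w]
    rw [← Matrix.det_updateCol_smul, ← Matrix.det_updateCol_add, hN, Matrix.det_fromBlocks_one₂₂]
    congr 1
    ext i j
    simp [Matrix.mul_apply, Matrix.vecMulVec_apply, mul_assoc]
  refine ⟨(N.updateCol (.inr ()) w).det, fun t => ?_⟩
  have hzero := hbordered 0
  rw [zero_smul, add_zero, zero_mul, add_zero] at hzero
  rw [hbordered, ← hzero]

-- The determinant is affine along the line that adds `t * x i` to every entry of row `i`, and at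
-- `t = -p` and `t = -q` the matrix is triangular.
theorem det_ite_lt_mul {ι R : Type*} [Fintype ι] [LinearOrder ι] [CommRing R] (x r : ι → R)
    (p q : R) :
    (q - p) * (Matrix.of fun i j =>
        if i < j then x i * p else if j < i then x i * q else r i).det =
      q * ∏ i, (r i - x i * p) - p * ∏ i, (r i - x i * q) := by
  set M : Matrix ι ι R :=
    Matrix.of fun i j => if i < j then x i * p else if j < i then x i * q else r i with hM
  obtain ⟨b, hb⟩ := exists_det_add_smul_vecMulVec M x 1
  have hlower : (M + (-p) • Matrix.vecMulVec x 1).det = ∏ i, (r i - x i * p) := by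
    rw [Matrix.det_of_isLowerTriangular]
    · exact Finset.prod_congr rfl fun i _ => by simp [hM]; ring
    · intro i j hij
      have hlt : i < j := hij
      simp [hM, hlt, mul_comm]
  have hupper : (M + (-q) • Matrix.vecMulVec x 1).det = ∏ i, (r i - x i * q) := by
    rw [Matrix.det_of_isUpperTriangular]
    · exact Finset.prod_congr rfl fun i _ => by simp [hM]; ring
    · intro i j hij
      have hlt : j < i := hij
      simp [hM, hlt, hlt.not_gt, mul_comm]
  rw [hb] at hlower hupper
  linear_combination q * hlower - p * hupper

/-- The matrix of weights of a step of a permutation from box `i` to box `j`, arranged so that the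
product of the weights of all steps of `π` is `c ^ (-exc π)` if `π` is in `starPerms` and `0`
otherwise. -/
noncomputable def stepWeight (m : ℕ) (c : ℝ) : Matrix (Fin (m + 1)) (Fin (m + 1)) ℝ :=
  Matrix.of fun i j => if i < j then c⁻¹ else if j < i then 1 else if i = 0 then 1 else 0

theorem bracket_eq_macMahonDet (m : ℕ) {c : ℝ} (hc0 : c ≠ 0) (hc1 : c ≠ 1) :
    bracket m c = macMahonDet (stepWeight m c) := by
  have hmatrix : 1 - Matrix.diagonal MvPolynomial.X * (stepWeight m c).map MvPolynomial.C =
      (Matrix.of fun i j => if i < j then -MvPolynomial.X i * MvPolynomial.C c⁻¹ else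
        if j < i then -MvPolynomial.X i * 1 else if i = 0 then 1 - MvPolynomial.X i else 1 :
          Matrix (Fin (m + 1)) (Fin (m + 1)) (MvPolynomial (Fin (m + 1)) ℝ)) := by
    ext1 i j
    rcases lt_trichotomy i j with h | rfl | h
    · simp [stepWeight, h, h.ne]
    · by_cases hi : i = 0 <;> simp [stepWeight, hi]
    · simp [stepWeight, h, h.ne', h.not_gt]
  have hdet := det_ite_lt_mul (fun i : Fin (m + 1) => -(MvPolynomial.X i : MvPolynomial _ ℝ))
    (fun i => if i = 0 then 1 - MvPolynomial.X i else 1) (MvPolynomial.C c⁻¹) 1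
  rw [← hmatrix, ← macMahonDet, Fin.prod_univ_succ, Fin.prod_univ_succ] at hdet
  simp only [Fin.succ_ne_zero, if_true, if_false, mul_comm _ (MvPolynomial.C c⁻¹), mul_neg,
    sub_neg_eq_add, mul_one, one_mul] at hdet
  have hunit : (MvPolynomial.C c * MvPolynomial.C c⁻¹ : MvPolynomial (Fin (m + 1)) ℝ) = 1 := by
    rw [← map_mul, mul_inv_cancel₀ hc0, map_one]
  have hratio : (MvPolynomial.C ((1 - c) / c) : MvPolynomial (Fin (m + 1)) ℝ) =
      MvPolynomial.C c⁻¹ - 1 := by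
    rw [sub_div, div_self hc0, map_sub, one_div, map_one]
  have hC : (MvPolynomial.C (1 - c) : MvPolynomial (Fin (m + 1)) ℝ) = 1 - MvPolynomial.C c := by
    rw [map_sub, map_one]
  refine mul_left_cancel₀ (MvPolynomial.C_ne_zero.mpr (sub_ne_zero.mpr hc1.symm)) ?_
  rw [C_mul_bracket m hc0 hc1, hratio, hC, one_div]
  set D := macMahonDet (stepWeight m c)
  set P : MvPolynomial (Fin (m + 1)) ℝ := ∏ j : Fin m, (1 + MvPolynomial.X j.succ)
  linear_combination MvPolynomial.C c * hdet + (D - P) * hunit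

end StepWeight

section Boxes

variable {m n₀ : ℕ} {n : Fin m → ℕ}

theorem prod_stepWeight (c : ℝ) (π : Equiv.Perm (Obj n₀ n)) :
    ∏ a, stepWeight m c a.1 (π a).1 = if π ∈ starPerms n₀ n then (c ^ exc π)⁻¹ else 0 := by
  split_ifs with hπ
  · have hmoved (a : Obj n₀ n) (ha : a.1 ≠ 0) : (π a).1 ≠ a.1 :=
      (Finset.mem_filter.mp hπ).2 a ha
    rw [exc, ← inv_pow, ← Finset.prod_const, Finset.prod_filter]
    refine Finset.prod_congr rfl fun a _ => ?_
    simp only [stepWeight, Matrix.of_apply]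
    grind
  · obtain ⟨a, ha₀, ha⟩ : ∃ a : Obj n₀ n, a.1 ≠ 0 ∧ (π a).1 = a.1 := by
      simpa [starPerms] using hπ
    exact Finset.prod_eq_zero (Finset.mem_univ a) (by simp [stepWeight, ha, ha₀])

theorem toFinsupp_map_fst (n₀ : ℕ) (n : Fin m → ℕ) :
    Multiset.toFinsupp ((Finset.univ : Finset (Obj n₀ n)).val.map Sigma.fst) =
      Finsupp.equivFunOnFinite.symm (Fin.cons n₀ n) := by
  ext i
  have e : {a : Obj n₀ n // i = a.1} ≃ Fin ((Fin.cons n₀ n : Fin (m + 1) → ℕ) i) :=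
    (Equiv.subtypeEquivRight fun a => eq_comm).trans (Equiv.sigmaSubtype i)
  rw [Multiset.toFinsupp_apply, Multiset.count_map, ← Finset.filter_val, Finset.card_val,
    ← Fintype.card_subtype, Fintype.card_congr e, Fintype.card_fin]
  rfl

theorem B_eq_sum_starPerms {β c : ℝ} (hβ : ∀ k : ℕ, β ≠ -k) (hc0 : c ≠ 0) (hc1 : |c| < 1)
    (n₀ : ℕ) (n : Fin m → ℕ) :
    B β c n₀ n = ∑ π ∈ starPerms n₀ n, β ^ cyc π * (c ^ exc π)⁻¹ := by
  have hcoeff : coeff (Finsupp.equivFunOnFinite.symm (Fin.cons n₀ n)) (genFun m β c) =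
      B β c n₀ n / ∏ i, (((Fin.cons n₀ n : Fin (m + 1) → ℕ) i).factorial : ℝ) := rfl
  have hcount (i : Fin (m + 1)) :
      ((Finset.univ : Finset (Obj n₀ n)).val.map Sigma.fst).count i =
        (Fin.cons n₀ n : Fin (m + 1) → ℕ) i := by
    rw [← Multiset.toFinsupp_apply, toFinsupp_map_fst, Finsupp.equivFunOnFinite_symm_apply_apply]
  symm
  calc ∑ π ∈ starPerms n₀ n, β ^ cyc π * (c ^ exc π)⁻¹
      = ∑ π : Equiv.Perm (Obj n₀ n), β ^ cyc π * ∏ a, stepWeight m c a.1 (π a).1 := by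
        simp only [prod_stepWeight, mul_ite, mul_zero, Finset.sum_ite_mem, Finset.univ_inter]
    _ = (∏ i, (((Fin.cons n₀ n : Fin (m + 1) → ℕ) i).factorial : ℝ)) *
          coeff (Finsupp.equivFunOnFinite.symm (Fin.cons n₀ n)) (genFun m β c) := by
        rw [sum_perm_pow_cyc (stepWeight m c) Sigma.fst, toFinsupp_map_fst,
          ← bracket_eq_macMahonDet m hc0 (abs_lt.mp hc1).2.ne,
          ← genFun_eq_seriesPow_bracket m hβ hc0 hc1]
        simp only [hcount]
    _ = B β c n₀ n := by
        rw [hcoeff, mul_div_cancel₀]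
        positivity

end Boxes

end Meixner

theorem mainTheorem9_general (m : ℕ) (β c : ℝ) (hβ : ∀ k : ℕ, β ≠ -k) (hc0 : c ≠ 0)
    (hc1 : |c| < 1) :
    (∀ (n₀ : ℕ) (n : Fin m → ℕ), Summable (Meixner.summand β c n₀ n)) ∧
    Meixner.genFun m β c =
      Meixner.seriesPow (Meixner.bracket m c : MvPowerSeries (Fin (m + 1)) ℝ) (-β) ∧
    ∀ (n₀ : ℕ) (n : Fin m → ℕ),
      Meixner.B β c n₀ n =
        ∑ π ∈ Meixner.starPerms n₀ n, β ^ Meixner.cyc π * (c ^ Meixner.exc π)⁻¹ :=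
  ⟨Meixner.summable_summand hβ hc0 hc1, Meixner.genFun_eq_seriesPow_bracket m hβ hc0 hc1,
    Meixner.B_eq_sum_starPerms hβ hc0 hc1⟩

theorem mainTheorem9 (m : ℕ) (β c : ℝ) (hβ : 0 < β) (hc0 : 0 < c) (hc1 : c < 1) :
    (∀ (n₀ : ℕ) (n : Fin m → ℕ), Summable (Meixner.summand β c n₀ n)) ∧
    Meixner.genFun m β c =
      Meixner.seriesPow (Meixner.bracket m c : MvPowerSeries (Fin (m + 1)) ℝ) (-β) ∧
    ∀ (n₀ : ℕ) (n : Fin m → ℕ),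
      Meixner.B β c n₀ n =
        ∑ π ∈ Meixner.starPerms n₀ n, β ^ Meixner.cyc π * (c ^ Meixner.exc π)⁻¹ :=
  mainTheorem9_general m β c
    (fun k => ((neg_nonpos.mpr k.cast_nonneg).trans_lt hβ).ne') hc0.ne'
    (abs_lt.mpr ⟨neg_one_lt_zero.trans hc0, hc1⟩)
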